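/- Let $K$ be a field. For integers $1\le c\le n$, a complete intersection $X(a_1,\dots,a_c)\subset\mathbb P^n_K$ of codimension $c$ is a subscheme defined by a regular sequence $f_1,\dots,f_c\in S=K[x_0,\dots,x_n]$ of homogeneous polynomials of degrees $a_i=\deg f_i\ge 1$; the tuple $(a_1,\dots,a_c)$ is its degree sequence. Its Hilbert polynomial is the polynomial $P_X\in\mathbb Q[t]$ such that $P_X(t)=\dim_K\big(S/(f_1,\dots,f_c)\big)_t$ for all sufficiently large integers $t$. Call the pair $(c,n)$, with $n\ge c$, *firm* if any two complete intersections $X(a_1,\dots,a_c)$ and $X(b_1,\dots,b_c)$ of codimension $c$ in $\mathbb P^n_K$ with the same Hilbert polynomial have the same degree sequence up to permutation. Let $N_c:=\min\{n\ge c : (c,n)\text{ is firm}\}$, and $N_c:=\infty$ if there is no such $n$. **Theorem.** $N_1=1$, $N_2=3$, $N_3=5$, $N_4=8$, $N_5=11$, $N_6=14$. -/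

import Mathlib

open MvPolynomial

/-- The sequence `f` of `c` forms in `K[x₀, …, xₙ]` cuts out a complete intersection
`X(a₁, …, a_c)` of codimension `c` in `ℙⁿ`: each `fᵢ` is homogeneous of degree `aᵢ ≥ 1`, and
`f₁, …, f_c` is a regular sequence. -/
structure IsCompleteIntersection (K : Type*) [Field K] {c n : ℕ} (a : Fin c → ℕ)
    (f : Fin c → MvPolynomial (Fin (n + 1)) K) : Prop where
  /-- The subscheme of `ℙⁿ` is non-empty, of dimension `n - c ≥ 0`. -/
  codim_le : c ≤ n
  degree_pos : ∀ i, 0 < a i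
  homogeneous : ∀ i, (f i).IsHomogeneous (a i)
  regular : RingTheory.Sequence.IsRegular (MvPolynomial (Fin (n + 1)) K) (List.ofFn f)

/-- The Hilbert function of `I ⊆ S = K[x₀, …, xₙ]`: the dimension over `K` of the degree-`t` part
`(S / I)_t` of the coordinate ring, that is, of the image of `S_t` in `S / I`. -/
noncomputable def hilbertFunction {K : Type*} [Field K] {n : ℕ}
    (I : Ideal (MvPolynomial (Fin (n + 1)) K)) (t : ℕ) : ℕ :=
  Module.finrank K
    ((homogeneousSubmodule (Fin (n + 1)) K t).map (Ideal.Quotient.mkₐ K I).toLinearMap)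

/-- `P` is a Hilbert polynomial of `I`: it agrees with the Hilbert function in all large degrees. -/
def IsHilbertPolynomial {K : Type*} [Field K] {n : ℕ}
    (I : Ideal (MvPolynomial (Fin (n + 1)) K)) (P : Polynomial ℚ) : Prop :=
  ∀ᶠ t : ℕ in Filter.atTop, P.eval (t : ℚ) = (hilbertFunction I t : ℚ)

theorem IsHilbertPolynomial.unique {K : Type*} [Field K] {n : ℕ}
    {I : Ideal (MvPolynomial (Fin (n + 1)) K)} {P Q : Polynomial ℚ}
    (hP : IsHilbertPolynomial I P) (hQ : IsHilbertPolynomial I Q) : P = Q := by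
  obtain ⟨N, hN⟩ := Filter.eventually_atTop.1 (hP.and hQ)
  refine Polynomial.eq_of_infinite_eval_eq P Q ?_
  refine Set.Infinite.mono ?_
    ((Set.Ici_infinite N).image (f := fun t : ℕ => (t : ℚ)) Nat.cast_injective.injOn)
  rintro _ ⟨t, ht, rfl⟩
  exact (hN t ht).1.trans (hN t ht).2.symm

open Classical in
/-- The Hilbert polynomial of `I` (the value `0` is a placeholder if there is none, which never
happens for a homogeneous ideal). -/
noncomputable def hilbertPolynomial {K : Type*} [Field K] {n : ℕ}
    (I : Ideal (MvPolynomial (Fin (n + 1)) K)) : Polynomial ℚ :=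
  if h : ∃ P, IsHilbertPolynomial I P then h.choose else 0

theorem IsHilbertPolynomial.hilbertPolynomial_eq {K : Type*} [Field K] {n : ℕ}
    {I : Ideal (MvPolynomial (Fin (n + 1)) K)} {P : Polynomial ℚ}
    (hP : IsHilbertPolynomial I P) : hilbertPolynomial I = P := by
  have h : ∃ P, IsHilbertPolynomial I P := ⟨P, hP⟩
  rw [hilbertPolynomial, dif_pos h]
  exact h.choose_spec.unique hP

/-- The pair `(c, n)`, `c ≤ n`, is firm over `K`: any two complete intersections of codimension `c`
in `ℙⁿ` with the same Hilbert polynomial have the same degrees up to a permutation. -/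
def Firm (K : Type*) [Field K] (c n : ℕ) : Prop :=
  c ≤ n ∧
    ∀ (a b : Fin c → ℕ) (f g : Fin c → MvPolynomial (Fin (n + 1)) K),
      IsCompleteIntersection K a f → IsCompleteIntersection K b g →
      hilbertPolynomial (Ideal.span (Set.range f)) = hilbertPolynomial (Ideal.span (Set.range g)) →
      ∃ σ : Equiv.Perm (Fin c), b = a ∘ σ

/-- `N_c`, the least `n` such that `(c, n)` is firm; it is `∞` if there is no such `n`. -/
noncomputable def firmnessIndex (K : Type*) [Field K] (c : ℕ) : ℕ∞ :=
  sInf ((fun n : ℕ => (n : ℕ∞)) '' {n : ℕ | Firm K c n})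

/-! The Hilbert polynomial of a complete intersection of degrees `a₁, …, a_c` arises from that of
`ℙⁿ`, a polynomial of degree `n`, by applying the difference operators `P(t) ↦ P(t) - P(t - aᵢ)`,
since each form of the regular sequence gives a short exact sequence of graded pieces
(`hilbertFunction_add`). In terms of the derivative `D` these operators are `1 - e^{-aᵢ D}`, and
a power series in `D` kills a polynomial of degree `n` only if it is divisible by `D ^ (n + 1)`.
Hence the Hilbert polynomial amounts to `∏ᵢ (1 - e^{-aᵢ s})` modulo `s ^ (n + 1)`
(`IsCompleteIntersection.hilbertPolynomial_eq_iff`). After division by `s ^ c`, this is the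
product `∏ aᵢ` together with the logarithmic derivative modulo `s ^ (n - c)`, whose coefficients are
`B_k p_k(a) / k!`, where `B_k` is a Bernoulli number and `p_k` a power sum. As every degree sequence
is realised by powers of variables, `(c, n)` is firm exactly if positive integers `a₁, …, a_c` are
determined up to order by their product and those of `p_1, p_2, p_4, p_6, …` of index at most
`n - c` (`firm_iff`).

The upper bounds use the elementary symmetric functions `e_k`. The product is `e_c`; `p_1` and `p_2`
give `e_1` and `e_2`; and equality of `p_4` means `Δe_4 = e_1 Δe_3`. This settles `c ≤ 4`. For
`c = 5`, equality of `p_6` makes `Δe_3` times the sum of the two values of `e_1 e_2 - e_3` zero, and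
`e_1 e_2 > e_3` for positive numbers. For `c = 6`, equality of `p_6` and `p_8` gives
`Δe_3 * (G(a) + G(b) + (Δe_3)² / 2) = 0`, where `G = e_1 e_2 e_3 - e_1² e_4 + e_1 e_5 - e_3²` is
a Hurwitz determinant of `∏ (T + aᵢ)`, hence nonnegative (`esymm_hurwitz_nonneg`).

The lower bounds come from explicit pairs of degree sequences, such as `(5, 12, 15, 32, 36, 46)` and
`(6, 8, 23, 24, 40, 45)`, which have the same product, `p_1`, `p_2`, `p_4` and `p_6`. -/

/-! ### Hilbert functions and regular sequences -/

attribute [local instance] MvPolynomial.gradedAlgebra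

theorem finrank_homogeneousSubmodule (K : Type*) [Field K] (n t : ℕ) :
    Module.finrank K (homogeneousSubmodule (Fin (n + 1)) K t) = (n + t).choose n := by
  have hset : {d : Fin (n + 1) →₀ ℕ | d.degree = t} =
      (↑((Finset.univ : Finset (Fin (n + 1))).finsuppAntidiag t) : Set (Fin (n + 1) →₀ ℕ)) := by
    ext d
    simp [Finset.mem_finsuppAntidiag, Finsupp.degree_eq_sum]
  rw [homogeneousSubmodule_eq_finsupp_supported, hset,
    (AddMonoidAlgebra.supportedEquivFinsupp _).finrank_eq, Module.finrank_finsupp_self]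
  simp only [Finset.coe_sort_coe, Fintype.card_coe]
  rw [Finset.card_finsuppAntidiag_nat_eq_choose, Finset.card_univ, Fintype.card_fin,
    show n + 1 + t - 1 = n + t by omega, Nat.choose_symm_add]

instance finite_homogeneousSubmodule (K : Type*) [Field K] (n t : ℕ) :
    Module.Finite K (homogeneousSubmodule (Fin (n + 1)) K t) :=
  Module.Finite.iff_fg.2 (homogeneousSubmodule_fg _ _ _)

theorem hilbertFunction_bot (K : Type*) [Field K] (n t : ℕ) :
    hilbertFunction (⊥ : Ideal (MvPolynomial (Fin (n + 1)) K)) t = (n + t).choose n := by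
  rw [hilbertFunction, ← finrank_homogeneousSubmodule K n t]
  refine (Submodule.equivMapOfInjective _ ?_ _).finrank_eq.symm
  rw [injective_iff_map_eq_zero]
  intro p hp
  exact Ideal.Quotient.eq_zero_iff_mem.1 hp

/-- Additivity of the Hilbert function along the exact sequence
`0 → (S / I)_t → (S / I)_{t+a} → (S / (I, f))_{t+a} → 0`, whose first map is multiplication by the
form `f` of degree `a`, a nonzerodivisor modulo `I`. -/
theorem hilbertFunction_add {K : Type*} [Field K] {n : ℕ}
    {I : Ideal (MvPolynomial (Fin (n + 1)) K)}
    (hI : I.IsHomogeneous (homogeneousSubmodule (Fin (n + 1)) K))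
    {f : MvPolynomial (Fin (n + 1)) K} {a : ℕ} (hf : f.IsHomogeneous a)
    (hreg : ∀ p, f * p ∈ I → p ∈ I) (t : ℕ) :
    hilbertFunction I (t + a) =
      hilbertFunction (I ⊔ Ideal.span {f}) (t + a) + hilbertFunction I t := by
  let S := MvPolynomial (Fin (n + 1)) K
  let J := I ⊔ Ideal.span {f}
  let V : Submodule K (S ⧸ I) :=
    (homogeneousSubmodule (Fin (n + 1)) K (t + a)).map (Ideal.Quotient.mkₐ K I).toLinearMap
  let π : (S ⧸ I) →ₗ[K] (S ⧸ J) := (Ideal.Quotient.factorₐ K (le_sup_left : I ≤ J)).toLinearMap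
  let L : V →ₗ[K] (S ⧸ J) := π.domRestrict V
  let μ : (S ⧸ I) →ₗ[K] (S ⧸ I) := LinearMap.mulLeft K (Ideal.Quotient.mk I f)
  have hμ : Function.Injective μ := by
    rw [injective_iff_map_eq_zero]
    intro x hx
    obtain ⟨p, rfl⟩ := Ideal.Quotient.mk_surjective x
    have hx' : Ideal.Quotient.mk I (f * p) = 0 := by simpa [μ] using hx
    rw [Ideal.Quotient.eq_zero_iff_mem] at hx' ⊢
    exact hreg p hx'
  have hrange : LinearMap.range L =
      (homogeneousSubmodule (Fin (n + 1)) K (t + a)).map (Ideal.Quotient.mkₐ K J).toLinearMap := by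
    rw [LinearMap.range_domRestrict, ← Submodule.map_comp]
    rfl
  have hker : (LinearMap.ker L).map V.subtype =
      ((homogeneousSubmodule (Fin (n + 1)) K t).map
        (Ideal.Quotient.mkₐ K I).toLinearMap).map μ := by
    ext x
    constructor
    · rintro ⟨⟨y, p, hp, rfl⟩, hy, rfl⟩
      have hpJ : p ∈ J := by
        rw [← Ideal.Quotient.eq_zero_iff_mem]
        exact hy
      obtain ⟨i, hi, g, hg, hsum⟩ := Submodule.mem_sup.1 hpJ
      obtain ⟨q, rfl⟩ := Ideal.mem_span_singleton'.1 hg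
      -- the component of degree `t + a` of `p = i + q * f` is `p = i_{t+a} + q_t * f`
      let 𝒜 := homogeneousSubmodule (Fin (n + 1)) K
      refine ⟨_, ⟨(DirectSum.decompose 𝒜 q t : S), (DirectSum.decompose 𝒜 q t).2, rfl⟩, ?_⟩
      have hcomp : p =
          (DirectSum.decompose 𝒜 i (t + a) : S) + (DirectSum.decompose 𝒜 q t : S) * f := by
        rw [← DirectSum.coe_decompose_mul_add_of_right_mem 𝒜 (i := t) hf, ← Submodule.coe_add,
          ← DirectSum.add_apply, ← DirectSum.decompose_add, hsum,
          DirectSum.decompose_of_mem_same 𝒜 hp]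
      change Ideal.Quotient.mk I f * Ideal.Quotient.mk I _ = Ideal.Quotient.mk I p
      rw [← map_mul, Ideal.Quotient.eq]
      have : f * (DirectSum.decompose 𝒜 q t : S) - p = -(DirectSum.decompose 𝒜 i (t + a) : S) := by
        linear_combination -hcomp
      rw [this]
      exact I.neg_mem (hI (t + a) hi)
    · rintro ⟨_, ⟨p, hp, rfl⟩, rfl⟩
      refine ⟨⟨Ideal.Quotient.mk I (f * p), f * p, ?_, rfl⟩, ?_, ?_⟩
      · rw [SetLike.mem_coe, mem_homogeneousSubmodule, add_comm t a]
        exact hf.mul hp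
      · change Ideal.Quotient.mk J (f * p) = 0
        rw [Ideal.Quotient.eq_zero_iff_mem]
        exact J.mul_mem_right _ (Ideal.mem_sup_right (Ideal.mem_span_singleton_self f))
      · simp [μ]
  have h := LinearMap.finrank_range_add_finrank_ker L
  rw [hrange, ← Submodule.finrank_map_subtype_eq V, hker,
    ← (Submodule.equivMapOfInjective μ hμ _).finrank_eq] at h
  exact h.symm

/-- The backward difference operator `P(t) ↦ P(t) - P(t - a)` on polynomials. -/
noncomputable def backwardDiff (a : ℕ) : Module.End ℚ (Polynomial ℚ) :=
  1 - Polynomial.taylor (-(a : ℚ))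

theorem eval_backwardDiff (a : ℕ) (P : Polynomial ℚ) (x : ℚ) :
    (backwardDiff a P).eval x = P.eval x - P.eval (x - a) := by
  simp [backwardDiff, Polynomial.taylor_eval, sub_eq_add_neg]

theorem isHilbertPolynomial_bot (K : Type*) [Field K] (n : ℕ) :
    IsHilbertPolynomial (⊥ : Ideal (MvPolynomial (Fin (n + 1)) K))
      (Polynomial.preHilbertPoly ℚ n 0) := by
  refine Filter.Eventually.of_forall fun t => ?_
  rw [hilbertFunction_bot, Polynomial.preHilbertPoly_eq_choose_sub_add ℚ n (Nat.zero_le t),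
    Nat.sub_zero, add_comm]

theorem IsHilbertPolynomial.sup_span_singleton {K : Type*} [Field K] {n : ℕ}
    {I : Ideal (MvPolynomial (Fin (n + 1)) K)}
    (hI : I.IsHomogeneous (homogeneousSubmodule (Fin (n + 1)) K)) {P : Polynomial ℚ}
    (hP : IsHilbertPolynomial I P)
    {f : MvPolynomial (Fin (n + 1)) K} {a : ℕ} (hf : f.IsHomogeneous a)
    (hreg : ∀ p, f * p ∈ I → p ∈ I) :
    IsHilbertPolynomial (I ⊔ Ideal.span {f}) (backwardDiff a P) := by
  obtain ⟨N, hN⟩ := Filter.eventually_atTop.1 hP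
  refine Filter.eventually_atTop.2 ⟨N + a, fun t ht => ?_⟩
  obtain ⟨s, rfl⟩ := Nat.exists_eq_add_of_le' (le_trans (Nat.le_add_left a N) ht)
  have h := hilbertFunction_add hI hf hreg s
  have h1 := hN (s + a) (by omega)
  have h2 := hN s (by omega)
  rw [eval_backwardDiff, h1, h]
  push_cast
  rw [add_sub_cancel_right, h2]
  ring

theorem isHilbertPolynomial_ofList {K : Type*} [Field K] {n : ℕ}
    (l : List (ℕ × MvPolynomial (Fin (n + 1)) K)) (hl : ∀ x ∈ l, x.2.IsHomogeneous x.1)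
    (hreg : RingTheory.Sequence.IsWeaklyRegular (MvPolynomial (Fin (n + 1)) K) (l.map Prod.snd)) :
    IsHilbertPolynomial (Ideal.ofList (l.map Prod.snd))
      ((l.map fun x => backwardDiff x.1).prod (Polynomial.preHilbertPoly ℚ n 0)) := by
  induction l using List.reverseRecOn with
  | nil => simpa using isHilbertPolynomial_bot K n
  | append_singleton l x ih =>
    rw [List.map_append, RingTheory.Sequence.isWeaklyRegular_append_iff] at hreg
    -- `List.prod` puts the operator of the last form first; the operators commute
    have hcomm : (List.map (fun x => backwardDiff x.1) (l ++ [x])).prod =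
        backwardDiff x.1 * (l.map fun x => backwardDiff x.1).prod := by
      have hc : ∀ a b, Commute (backwardDiff a) (backwardDiff b) := by
        intro a b
        refine ((Commute.one_left _).sub_left ((Commute.one_right _).sub_right ?_))
        refine LinearMap.ext fun P => ?_
        change Polynomial.taylor _ (Polynomial.taylor _ P) =
          Polynomial.taylor _ (Polynomial.taylor _ P)
        rw [Polynomial.taylor_taylor, Polynomial.taylor_taylor, add_comm]
      rw [List.map_append, List.prod_append, List.map_singleton, List.prod_singleton]
      refine (Commute.list_prod_right _ _ ?_).eq.symm
      intro z hz
      obtain ⟨y, -, rfl⟩ := List.mem_map.1 hz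
      exact hc _ _
    rw [List.map_append, Ideal.ofList_append, List.map_singleton, Ideal.ofList_singleton, hcomm,
      Module.End.mul_apply]
    refine IsHilbertPolynomial.sup_span_singleton ?_
      (ih (fun y hy => hl y (by simp [hy])) hreg.1) (hl x (by simp)) ?_
    · refine Ideal.homogeneous_span _ _ ?_
      intro p hp
      obtain ⟨y, hy, rfl⟩ := List.mem_map.1 hp
      exact ⟨y.1, hl y (by simp [hy])⟩
    · intro p hp
      have h2 := (RingTheory.Sequence.isWeaklyRegular_singleton_iff _ _).1 hreg.2
      rw [isSMulRegular_iff_right_eq_zero_of_smul] at h2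
      have := h2 (Submodule.Quotient.mk p) (by
        rw [← Submodule.Quotient.mk_smul, Submodule.Quotient.mk_eq_zero]
        simpa using hp)
      rw [Submodule.Quotient.mk_eq_zero] at this
      simpa using this

theorem IsCompleteIntersection.hilbertPolynomial_eq {K : Type*} [Field K] {c n : ℕ}
    {a : Fin c → ℕ} {f : Fin c → MvPolynomial (Fin (n + 1)) K} (h : IsCompleteIntersection K a f) :
    hilbertPolynomial (Ideal.span (Set.range f)) =
      (List.ofFn fun i => backwardDiff (a i)).prod (Polynomial.preHilbertPoly ℚ n 0) := by
  apply IsHilbertPolynomial.hilbertPolynomial_eq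
  have := isHilbertPolynomial_ofList (List.ofFn fun i => (a i, f i)) (by
    simp only [List.mem_ofFn]
    rintro _ ⟨i, rfl⟩
    exact h.homogeneous i) (by simpa [List.map_ofFn, Function.comp_def] using h.regular.1)
  simpa [List.map_ofFn, Function.comp_def, Ideal.ofList, List.mem_ofFn, Set.range] using this

/-! ### Complete intersections of powers of variables -/

theorem mem_span_X_pow {K σ : Type*} [Field K] (s : Set σ) (a : σ → ℕ) (p : MvPolynomial σ K) :
    p ∈ Ideal.span ((fun i => (X i : MvPolynomial σ K) ^ a i) '' s) ↔
      ∀ m ∈ p.support, ∃ i ∈ s, a i ≤ m i := by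
  have h := @mem_ideal_span_monomial_image σ K _ p ((fun i => Finsupp.single i (a i)) '' s)
  rw [Set.image_image] at h
  simp only [← X_pow_eq_monomial] at h
  rw [h]
  simp [Finsupp.single_le_iff]

theorem mem_span_X_pow_of_mul_mem {K σ : Type*} [Field K] {s : Set σ} {a : σ → ℕ} {i : σ}
    (hi : i ∉ s) (b : ℕ) {p : MvPolynomial σ K}
    (h : X i ^ b * p ∈ Ideal.span ((fun i => (X i : MvPolynomial σ K) ^ a i) '' s)) :
    p ∈ Ideal.span ((fun i => (X i : MvPolynomial σ K) ^ a i) '' s) := by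
  rw [mem_span_X_pow] at h ⊢
  intro m hm
  obtain ⟨j, hj, hle⟩ := h (Finsupp.single i b + m) (by
    rw [mem_support_iff, X_pow_eq_monomial, coeff_monomial_mul, one_mul]
    exact mem_support_iff.1 hm)
  have hij : i ≠ j := fun h => hi (h ▸ hj)
  exact ⟨j, hj, by simpa [Finsupp.single_eq_of_ne' hij] using hle⟩

/-- Every degree sequence is realised over every field, by powers of distinct variables. -/
theorem isCompleteIntersection_X_pow (K : Type*) [Field K] {c n : ℕ} (hcn : c ≤ n) (a : Fin c → ℕ)
    (ha : ∀ i, 0 < a i) :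
    IsCompleteIntersection K a
      fun i => (X (Fin.castLE (hcn.trans n.le_succ) i) : MvPolynomial (Fin (n + 1)) K) ^ a i := by
  let ι : Fin c → Fin (n + 1) := Fin.castLE (hcn.trans n.le_succ)
  have hι : Function.Injective ι := Fin.castLE_injective _
  let a' : Fin (n + 1) → ℕ := Function.extend ι a 0
  have ha' : ∀ i, a' (ι i) = a i := fun i => hι.extend_apply a 0 i
  have hspan : ∀ k, Ideal.ofList
      ((List.ofFn fun i => (X (ι i) : MvPolynomial (Fin (n + 1)) K) ^ a i).take k) =
        Ideal.span ((fun i => (X i : MvPolynomial (Fin (n + 1)) K) ^ a' i) ''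
          (ι '' {i | i.1 < k})) := by
    intro k
    rw [Ideal.ofList, Set.image_image]
    congr 1
    ext p
    simp only [List.mem_take_iff_getElem, List.getElem_ofFn, Set.mem_ofPred_eq, Set.mem_image, ha']
    constructor
    · rintro ⟨i, hi, rfl⟩
      rw [List.length_ofFn, lt_min_iff] at hi
      exact ⟨⟨i, hi.2⟩, hi.1, rfl⟩
    · rintro ⟨i, hi, rfl⟩
      exact ⟨i, by rw [List.length_ofFn, lt_min_iff]; exact ⟨hi, i.2⟩, rfl⟩
  refine ⟨hcn, ha, fun i => by simpa using (isHomogeneous_X K (ι i)).pow (a i), ⟨⟨?_⟩, ?_⟩⟩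
  · intro k hk
    rw [List.length_ofFn] at hk
    rw [isSMulRegular_iff_right_eq_zero_of_smul]
    intro x hx
    obtain ⟨p, rfl⟩ := Submodule.Quotient.mk_surjective _ x
    rw [← Submodule.Quotient.mk_smul, Submodule.Quotient.mk_eq_zero] at hx
    rw [Submodule.Quotient.mk_eq_zero]
    rw [smul_eq_mul, Ideal.mul_top, List.getElem_ofFn, smul_eq_mul] at hx
    rw [smul_eq_mul, Ideal.mul_top]
    change _ ∈ Ideal.ofList _ at hx
    change _ ∈ Ideal.ofList _
    rw [hspan] at hx ⊢
    refine mem_span_X_pow_of_mul_mem ?_ _ hx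
    rintro ⟨j, hj, hjk⟩
    obtain rfl := hι hjk
    exact lt_irrefl k hj
  · intro h
    have h1 : (1 : MvPolynomial (Fin (n + 1)) K) ∈ Ideal.ofList
        ((List.ofFn fun i => (X (ι i) : MvPolynomial (Fin (n + 1)) K) ^ a i).take c) := by
      rw [List.take_of_length_le (by simp)]
      have h2 : (1 : MvPolynomial (Fin (n + 1)) K) ∈
          (⊤ : Submodule (MvPolynomial (Fin (n + 1)) K) (MvPolynomial (Fin (n + 1)) K)) :=
        Submodule.mem_top
      rw [h, smul_eq_mul, Ideal.mul_top] at h2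
      exact h2
    rw [hspan, mem_span_X_pow] at h1
    obtain ⟨_, ⟨i, -, rfl⟩, hi⟩ := h1 0 (by simp)
    rw [ha'] at hi
    exact (ha i).not_ge hi

/-! ### Difference operators as power series in the derivative -/

/-- Taylor's formula in the form `P(t + r) = (e^{rD} P)(t)`, where `D` is the derivative; the
exponential series may be cut off above the degree of `P`. -/
theorem taylor_eq_aeval_derivative (r : ℚ) {N : ℕ} {P : Polynomial ℚ} (hP : P.natDegree < N) :
    Polynomial.taylor r P = Polynomial.aeval Polynomial.derivative
      (PowerSeries.trunc N (PowerSeries.rescale r (PowerSeries.exp ℚ))) P := by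
  refine Polynomial.funext fun x => ?_
  have h1 : (Polynomial.taylor r P).eval x = (Polynomial.taylor x P).eval r := by
    rw [Polynomial.taylor_eval, Polynomial.taylor_eval, add_comm]
  rw [h1, Polynomial.eval_eq_sum_range' (by rwa [Polynomial.natDegree_taylor]),
    Polynomial.aeval_def, PowerSeries.eval₂_trunc_eq_sum_range, LinearMap.sum_apply,
    Polynomial.eval_finsetSum]
  refine Finset.sum_congr rfl fun j _ => ?_
  rw [Polynomial.taylor_coeff, Module.End.mul_apply, Module.End.pow_apply,
    ← Polynomial.factorial_smul_hasseDeriv, Module.algebraMap_end_apply]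
  have := j.factorial_ne_zero
  simp [PowerSeries.coeff_rescale, PowerSeries.coeff_exp]
  field_simp

theorem backwardDiff_eq_aeval_derivative (a : ℕ) {N : ℕ} {P : Polynomial ℚ}
    (hP : P.natDegree < N) :
    backwardDiff a P = Polynomial.aeval Polynomial.derivative
      (PowerSeries.trunc N (1 - PowerSeries.rescale (-(a : ℚ)) (PowerSeries.exp ℚ))) P := by
  obtain ⟨N, rfl⟩ := Nat.exists_eq_succ_of_ne_zero (Nat.ne_zero_of_lt hP)
  rw [PowerSeries.trunc_sub, map_sub, PowerSeries.trunc_one, map_one, LinearMap.sub_apply,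
    ← taylor_eq_aeval_derivative _ hP]
  rfl

theorem prod_backwardDiff_eq_aeval_derivative {N : ℕ} {P : Polynomial ℚ} (hP : P.natDegree < N)
    (l : List ℕ) :
    (l.map backwardDiff).prod P = Polynomial.aeval Polynomial.derivative
      (l.map fun a : ℕ => PowerSeries.trunc N
        (1 - PowerSeries.rescale (-(a : ℚ)) (PowerSeries.exp ℚ))).prod P ∧
      ((l.map backwardDiff).prod P).natDegree < N := by
  induction l with
  | nil => simpa using hP
  | cons a l ih =>
    rw [List.map_cons, List.prod_cons, List.map_cons, List.prod_cons, map_mul,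
      Module.End.mul_apply, Module.End.mul_apply, ← ih.1]
    refine ⟨backwardDiff_eq_aeval_derivative a ih.2, ?_⟩
    refine (Polynomial.natDegree_sub_le _ _).trans_lt ?_
    rw [Polynomial.natDegree_taylor, Module.End.one_apply, max_self]
    exact ih.2

theorem coeff_aeval_derivative (p Q : Polynomial ℚ) (k : ℕ) :
    (Polynomial.aeval Polynomial.derivative p Q).coeff k =
      p.sum fun j x => x * ((k + j).descFactorial j * Q.coeff (k + j)) := by
  rw [Polynomial.aeval_eq_sum_range, Polynomial.sum_over_range _ (by simp), LinearMap.sum_apply,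
    Polynomial.finsetSum_coeff]
  refine Finset.sum_congr rfl fun j _ => ?_
  rw [LinearMap.smul_apply, Module.End.pow_apply, Polynomial.coeff_smul,
    Polynomial.coeff_iterate_derivative, smul_eq_mul, nsmul_eq_mul]

/-- The annihilator of a nonzero polynomial of degree `n` under the action of `ℚ[D]` is
generated by `D ^ (n + 1)`. -/
theorem aeval_derivative_eq_zero_iff {Q : Polynomial ℚ} (hQ : Q ≠ 0) (p : Polynomial ℚ) :
    Polynomial.aeval Polynomial.derivative p Q = 0 ↔ Polynomial.X ^ (Q.natDegree + 1) ∣ p := by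
  constructor
  · intro h
    rw [Polynomial.X_pow_dvd_iff]
    intro d
    induction d using Nat.strong_induction_on with
    | _ d ih =>
      intro hd
      -- compare coefficients in degree `deg Q - d`, which only the term of order `d` reaches
      obtain ⟨k, hk⟩ := Nat.exists_eq_add_of_le' (Nat.le_of_lt_succ hd)
      have hc := congrArg (fun R => R.coeff k) h
      simp only [coeff_aeval_derivative, Polynomial.coeff_zero] at hc
      rw [Polynomial.sum_def, Finset.sum_eq_single d] at hc
      · have h1 : ((k + d).descFactorial d : ℚ) ≠ 0 := by
          rw [Nat.cast_ne_zero, ← Nat.pos_iff_ne_zero, Nat.descFactorial_pos]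
          omega
        have h2 : Q.coeff (k + d) ≠ 0 := by
          rw [← hk]
          exact Polynomial.leadingCoeff_ne_zero.2 hQ
        exact (mul_eq_zero.1 hc).resolve_right (mul_ne_zero h1 h2)
      · intro j _ hj
        rcases lt_or_gt_of_ne hj with hj | hj
        · rw [ih j hj (hj.trans hd), zero_mul]
        · rw [Polynomial.coeff_eq_zero_of_natDegree_lt (p := Q) (by omega), mul_zero, mul_zero]
      · intro hd
        rw [Polynomial.notMem_support_iff.1 hd, zero_mul]
  · rintro ⟨r, rfl⟩
    rw [mul_comm, map_mul, Module.End.mul_apply, map_pow, Polynomial.aeval_X, Module.End.pow_apply,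
      Polynomial.iterate_derivative_eq_zero (Nat.lt_succ_self _), map_zero]

theorem X_pow_dvd_coe_iff {N : ℕ} {p : Polynomial ℚ} :
    (PowerSeries.X : PowerSeries ℚ) ^ N ∣ (p : PowerSeries ℚ) ↔ Polynomial.X ^ N ∣ p := by
  simp [PowerSeries.X_pow_dvd_iff, Polynomial.X_pow_dvd_iff]

theorem X_pow_dvd_coe_trunc_sub (N : ℕ) (φ : PowerSeries ℚ) :
    PowerSeries.X ^ N ∣ (PowerSeries.trunc N φ : PowerSeries ℚ) - φ := by
  rw [PowerSeries.X_pow_dvd_iff]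
  intro m hm
  rw [map_sub, PowerSeries.coeff_coe_trunc_of_lt hm, sub_self]

/-- The power series `∏ᵢ (1 - e^{-aᵢ s})`: the numerator `∏ᵢ (1 - z^{aᵢ})` of the Hilbert series of
a complete intersection of degrees `a`, at `z = e^{-s}`. -/
noncomputable def koszulSeries {c : ℕ} (a : Fin c → ℕ) : PowerSeries ℚ :=
  ∏ i, (1 - PowerSeries.rescale (-(a i : ℚ)) (PowerSeries.exp ℚ))

theorem X_pow_dvd_coe_prod_trunc_sub (N : ℕ) {c : ℕ} (a : Fin c → ℕ) :
    PowerSeries.X ^ N ∣ ((∏ i, PowerSeries.trunc N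
      (1 - PowerSeries.rescale (-(a i : ℚ)) (PowerSeries.exp ℚ)) : Polynomial ℚ) : PowerSeries ℚ) -
        koszulSeries a := by
  rw [← Ideal.mem_span_singleton, ← Ideal.Quotient.eq, koszulSeries,
    ← Polynomial.coeToPowerSeries.ringHom_apply, map_prod, map_prod, map_prod]
  refine Finset.prod_congr rfl fun i _ => ?_
  rw [Ideal.Quotient.eq, Ideal.mem_span_singleton]
  exact X_pow_dvd_coe_trunc_sub N _

/-- The Hilbert polynomial is the image of a polynomial of degree `n` under the power series
`koszulSeries` in the derivative, so it determines exactly this series modulo `s ^ (n + 1)`. -/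
theorem IsCompleteIntersection.hilbertPolynomial_eq_iff {K : Type*} [Field K] {c n : ℕ}
    {a b : Fin c → ℕ} {f g : Fin c → MvPolynomial (Fin (n + 1)) K}
    (ha : IsCompleteIntersection K a f) (hb : IsCompleteIntersection K b g) :
    hilbertPolynomial (Ideal.span (Set.range f)) = hilbertPolynomial (Ideal.span (Set.range g)) ↔
      PowerSeries.X ^ (n + 1) ∣ koszulSeries a - koszulSeries b := by
  have hQ : (Polynomial.preHilbertPoly ℚ n 0).natDegree = n :=
    Polynomial.natDegree_preHilbertPoly ℚ n 0
  have hQ0 : Polynomial.preHilbertPoly ℚ n 0 ≠ 0 := by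
    intro h
    have := Polynomial.coeff_preHilbertPoly_self ℚ n 0
    rw [h, Polynomial.coeff_zero] at this
    exact inv_ne_zero (Nat.cast_ne_zero.2 n.factorial_ne_zero) this.symm
  have key : ∀ a : Fin c → ℕ, (List.ofFn fun i => backwardDiff (a i)).prod
      (Polynomial.preHilbertPoly ℚ n 0) = Polynomial.aeval Polynomial.derivative
        (∏ i, PowerSeries.trunc (n + 1)
          (1 - PowerSeries.rescale (-(a i : ℚ)) (PowerSeries.exp ℚ)))
        (Polynomial.preHilbertPoly ℚ n 0) := by
    intro a
    have h := (prod_backwardDiff_eq_aeval_derivative (hQ.trans_lt n.lt_succ_self)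
      (List.ofFn a)).1
    rw [List.map_ofFn, List.map_ofFn, List.prod_ofFn (f := _ ∘ _)] at h
    exact h
  rw [ha.hilbertPolynomial_eq, hb.hilbertPolynomial_eq, key, key, ← sub_eq_zero,
    ← LinearMap.sub_apply, ← map_sub, aeval_derivative_eq_zero_iff hQ0, hQ, ← X_pow_dvd_coe_iff,
    Polynomial.coe_sub]
  have h1 := X_pow_dvd_coe_prod_trunc_sub (n + 1) a
  have h2 := X_pow_dvd_coe_prod_trunc_sub (n + 1) b
  refine dvd_iff_dvd_of_dvd_sub ?_
  rw [sub_sub_sub_comm]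
  exact dvd_sub h1 h2

/-! ### Logarithmic derivatives and power sums -/

/-- The power series `ψ(s) = (1 - e^{-s}) / s`. -/
noncomputable def oneSubExpNegDivX : PowerSeries ℚ :=
  PowerSeries.mk fun k => (-1) ^ k / ((k + 1).factorial : ℚ)

/-- The logarithmic derivative `ψ' / ψ = ∑ₖ B_{k+1} s^k / (k+1)!` of `ψ(s) = (1 - e^{-s}) / s`. -/
noncomputable def logDerivOneSubExpNegDivX : PowerSeries ℚ :=
  PowerSeries.mk fun k => bernoulli (k + 1) / ((k + 1).factorial : ℚ)

theorem one_sub_rescale_exp (a : ℚ) :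
    1 - PowerSeries.rescale (-a) (PowerSeries.exp ℚ) =
      PowerSeries.X * (PowerSeries.C a * PowerSeries.rescale a oneSubExpNegDivX) := by
  ext k
  rcases k with _ | k
  · rw [map_sub, PowerSeries.coeff_rescale]
    simp
  · rw [PowerSeries.coeff_succ_X_mul, map_sub, PowerSeries.coeff_rescale, PowerSeries.coeff_exp,
      PowerSeries.coeff_C_mul, PowerSeries.coeff_rescale, oneSubExpNegDivX, PowerSeries.coeff_mk,
      PowerSeries.coeff_one, if_neg k.succ_ne_zero, neg_pow a]
    simp only [Algebra.algebraMap_self, RingHom.id_apply]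
    ring

theorem X_mul_logDeriv_add_one :
    PowerSeries.X * logDerivOneSubExpNegDivX + 1 = bernoulliPowerSeries ℚ := by
  ext k
  rcases k with _ | k
  · simp [bernoulliPowerSeries]
  · rw [map_add, PowerSeries.coeff_succ_X_mul]
    simp [bernoulliPowerSeries, logDerivOneSubExpNegDivX, PowerSeries.coeff_one]

theorem derivative_oneSubExpNegDivX :
    PowerSeries.derivative ℚ oneSubExpNegDivX =
      oneSubExpNegDivX * logDerivOneSubExpNegDivX := by
  set E := PowerSeries.rescale (-1 : ℚ) (PowerSeries.exp ℚ) with hE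
  have hψ : 1 - E = PowerSeries.X * oneSubExpNegDivX := by
    simpa using one_sub_rescale_exp 1
  have hEe : PowerSeries.exp ℚ * E = 1 := PowerSeries.exp_mul_exp_neg_eq_one
  have hB := bernoulliPowerSeries_mul_exp_sub_one ℚ
  rw [← X_mul_logDeriv_add_one] at hB
  have hE' : PowerSeries.derivative ℚ E = -E := by
    ext k
    simp [hE, PowerSeries.coeff_derivative, PowerSeries.coeff_rescale, PowerSeries.coeff_exp,
      Nat.factorial_succ, pow_succ]
    have := k.factorial_ne_zero
    field_simp
  have hd := congrArg (PowerSeries.derivative ℚ) hψ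
  rw [map_sub, hE', Derivation.leibniz, PowerSeries.derivative_X, Derivation.map_one_eq_zero,
    zero_sub, neg_neg, smul_eq_mul, smul_eq_mul, mul_one] at hd
  have hX : (PowerSeries.X : PowerSeries ℚ) ≠ 0 := PowerSeries.X_ne_zero
  -- the generating function of the Bernoulli numbers is `s / (e^s - 1) = e^{-s} / ψ`
  have h1 : (PowerSeries.X * logDerivOneSubExpNegDivX + 1) * oneSubExpNegDivX = E := by
    apply mul_left_cancel₀ hX
    linear_combination E * hB - (PowerSeries.X * logDerivOneSubExpNegDivX + 1) * (hEe + hψ)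
  apply mul_left_cancel₀ hX
  linear_combination -h1 - hd

theorem derivative_C_mul_rescale {φ L : PowerSeries ℚ} (h : PowerSeries.derivative ℚ φ = φ * L)
    (a : ℚ) :
    PowerSeries.derivative ℚ (PowerSeries.C a * PowerSeries.rescale a φ) =
      PowerSeries.C a * PowerSeries.rescale a φ * (PowerSeries.C a * PowerSeries.rescale a L) := by
  have h1 : PowerSeries.derivative ℚ (PowerSeries.rescale a φ) =
      PowerSeries.C a * PowerSeries.rescale a (PowerSeries.derivative ℚ φ) := by
    ext k
    simp [PowerSeries.coeff_derivative, PowerSeries.coeff_rescale]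
    ring
  rw [Derivation.leibniz, h1, h]
  simp
  ring

theorem derivative_prod {ι : Type*} (s : Finset ι) {F L : ι → PowerSeries ℚ}
    (h : ∀ i ∈ s, PowerSeries.derivative ℚ (F i) = F i * L i) :
    PowerSeries.derivative ℚ (∏ i ∈ s, F i) = (∏ i ∈ s, F i) * ∑ i ∈ s, L i := by
  classical
  induction s using Finset.induction_on with
  | empty => simp
  | insert i s hi ih =>
    rw [Finset.prod_insert hi, Finset.sum_insert hi, Derivation.leibniz, h i (by simp),
      ih fun j hj => h j (by simp [hj])]
    simp only [smul_eq_mul]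
    ring

/-- Agreement to order `m + 1` of two power series is agreement of their constant terms together
with agreement to order `m` of their logarithmic derivatives `L` and `M`. -/
theorem X_pow_succ_dvd_sub_iff {F G L M : PowerSeries ℚ}
    (hF : PowerSeries.derivative ℚ F = F * L) (hG : PowerSeries.derivative ℚ G = G * M)
    (hF0 : PowerSeries.constantCoeff F ≠ 0) (m : ℕ) :
    PowerSeries.X ^ (m + 1) ∣ F - G ↔
      PowerSeries.constantCoeff F = PowerSeries.constantCoeff G ∧ PowerSeries.X ^ m ∣ L - M := by
  have hd : PowerSeries.derivative ℚ (F - G) = F * (L - M) + (F - G) * M := by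
    rw [map_sub, hF, hG]; ring
  have hc : ∀ k, PowerSeries.coeff (k + 1) (F - G) * (k + 1) =
      PowerSeries.coeff k (F * (L - M) + (F - G) * M) := by
    intro k
    rw [← hd, PowerSeries.coeff_derivative]
  constructor
  · intro h
    have h0 := PowerSeries.X_pow_dvd_iff.1 h 0 m.succ_pos
    refine ⟨by simpa [sub_eq_zero] using h0, ?_⟩
    have h1 : PowerSeries.X ^ m ∣ F * (L - M) + (F - G) * M := by
      rw [PowerSeries.X_pow_dvd_iff]
      intro k hk
      rw [← hc, PowerSeries.X_pow_dvd_iff.1 h (k + 1) (by omega), zero_mul]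
    have h2 : PowerSeries.X ^ m ∣ F * (L - M) :=
      (dvd_add_left (((pow_dvd_pow _ m.le_succ).trans h).mul_right M)).1 h1
    have hu : IsUnit F := PowerSeries.isUnit_iff_constantCoeff.2 (isUnit_iff_ne_zero.2 hF0)
    exact hu.dvd_mul_left.1 h2
  · rintro ⟨h0, h⟩
    suffices H : ∀ k ≤ m, PowerSeries.X ^ (k + 1) ∣ F - G from H m le_rfl
    intro k
    induction k with
    | zero =>
      intro _
      rw [zero_add, pow_one, PowerSeries.X_dvd_iff, map_sub, h0, sub_self]
    | succ k ih =>
      intro hk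
      have ih := ih (by omega)
      rw [PowerSeries.X_pow_dvd_iff]
      intro j hj
      rcases Nat.lt_succ_iff_lt_or_eq.1 hj with hj | rfl
      · exact PowerSeries.X_pow_dvd_iff.1 ih j hj
      · have h3 : PowerSeries.X ^ (k + 1) ∣ F * (L - M) + (F - G) * M :=
          dvd_add (((pow_dvd_pow _ hk).trans h).mul_left F) (ih.mul_right M)
        have h4 := (hc k).trans (PowerSeries.X_pow_dvd_iff.1 h3 k k.lt_succ_self)
        exact (mul_eq_zero.1 h4).resolve_right (by positivity)

/-- Each factor `1 - e^{-aᵢ s}` is `s` times `aᵢ ψ(aᵢ s)`, which costs `c` orders of precision. The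
rest has constant term `∏ᵢ aᵢ`, and its logarithmic derivative has the power sums of the `aᵢ`,
weighted by Bernoulli numbers, as coefficients. -/
theorem X_pow_dvd_koszulSeries_sub_iff {c n : ℕ} (hcn : c ≤ n) {a b : Fin c → ℕ}
    (ha : ∀ i, 0 < a i) :
    PowerSeries.X ^ (n + 1) ∣ koszulSeries a - koszulSeries b ↔
      ∏ i, a i = ∏ i, b i ∧ ∀ k, k < n - c → bernoulli (k + 1) ≠ 0 →
        ∑ i, a i ^ (k + 1) = ∑ i, b i ^ (k + 1) := by
  obtain ⟨m, rfl⟩ := Nat.exists_eq_add_of_le hcn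
  let F : (Fin c → ℕ) → PowerSeries ℚ := fun a =>
    ∏ i, PowerSeries.C (a i : ℚ) * PowerSeries.rescale (a i : ℚ) oneSubExpNegDivX
  let Λ : (Fin c → ℕ) → PowerSeries ℚ := fun a =>
    ∑ i, PowerSeries.C (a i : ℚ) * PowerSeries.rescale (a i : ℚ) logDerivOneSubExpNegDivX
  have hΛ : ∀ a k, PowerSeries.coeff k (Λ a) =
      bernoulli (k + 1) / ((k + 1).factorial : ℚ) * ((∑ i, a i ^ (k + 1) : ℕ) : ℚ) := by
    intro a k
    simp only [Λ, map_sum, PowerSeries.coeff_C_mul, PowerSeries.coeff_rescale,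
      logDerivOneSubExpNegDivX, PowerSeries.coeff_mk, Nat.cast_sum, Nat.cast_pow, Finset.mul_sum]
    exact Finset.sum_congr rfl fun i _ => by ring
  have hF : ∀ a, PowerSeries.derivative ℚ (F a) = F a * Λ a := fun a =>
    derivative_prod _ fun i _ => derivative_C_mul_rescale derivative_oneSubExpNegDivX _
  have hF0 : ∀ a, PowerSeries.constantCoeff (F a) = ((∏ i, a i : ℕ) : ℚ) := by
    intro a
    simp only [F, map_prod, map_mul, Nat.cast_prod]
    refine Finset.prod_congr rfl fun i _ => ?_
    rw [← PowerSeries.coeff_zero_eq_constantCoeff_apply,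
      ← PowerSeries.coeff_zero_eq_constantCoeff_apply, PowerSeries.coeff_rescale]
    simp [oneSubExpNegDivX]
  have hK : ∀ a, koszulSeries a = PowerSeries.X ^ c * F a := by
    intro a
    simp only [koszulSeries, F, one_sub_rescale_exp, Finset.prod_mul_distrib, Finset.prod_const,
      Finset.card_univ, Fintype.card_fin]
  rw [hK, hK, ← mul_sub, add_assoc, pow_add,
    mul_dvd_mul_iff_left (pow_ne_zero c PowerSeries.X_ne_zero),
    X_pow_succ_dvd_sub_iff (hF a) (hF b), hF0, hF0, Nat.cast_inj, Nat.add_sub_cancel_left,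
    PowerSeries.X_pow_dvd_iff]
  · refine and_congr_right fun _ => forall₂_congr fun k _ => ?_
    have := (k + 1).factorial_ne_zero
    rw [map_sub, hΛ, hΛ, ← mul_sub, mul_eq_zero, sub_eq_zero, Nat.cast_inj, div_eq_zero_iff,
      or_iff_not_imp_left]
    simp [this]
  · rw [hF0, Nat.cast_ne_zero, Finset.prod_ne_zero_iff]
    exact fun i _ => (ha i).ne'

/-- Firmness is a question about positive integers: the Hilbert polynomial determines exactly the
product of the degrees and their power sums of the exponents `1 ≤ k ≤ n - c` with `B_k ≠ 0`. -/
theorem firm_iff (K : Type*) [Field K] {c n : ℕ} (hcn : c ≤ n) :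
    Firm K c n ↔ ∀ a b : Fin c → ℕ, (∀ i, 0 < a i) → (∀ i, 0 < b i) → ∏ i, a i = ∏ i, b i →
      (∀ k, k < n - c → bernoulli (k + 1) ≠ 0 → ∑ i, a i ^ (k + 1) = ∑ i, b i ^ (k + 1)) →
      ∃ σ : Equiv.Perm (Fin c), b = a ∘ σ := by
  constructor
  · rintro ⟨-, h⟩ a b ha hb h1 h2
    have hA := isCompleteIntersection_X_pow K hcn a ha
    have hB := isCompleteIntersection_X_pow K hcn b hb
    exact h a b _ _ hA hB ((hA.hilbertPolynomial_eq_iff hB).2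
      ((X_pow_dvd_koszulSeries_sub_iff hcn ha).2 ⟨h1, h2⟩))
  · intro h
    refine ⟨hcn, fun a b f g hf hg hfg => ?_⟩
    obtain ⟨h1, h2⟩ := (X_pow_dvd_koszulSeries_sub_iff hcn hf.degree_pos).1
      ((hf.hilbertPolynomial_eq_iff hg).1 hfg)
    exact h a b hf.degree_pos hg.degree_pos h1 h2

/-! ### Symmetric functions of a degree sequence -/

/-- The `k`-th elementary symmetric function of a degree sequence, as a rational number. -/
noncomputable def degreeEsymm {c : ℕ} (a : Fin c → ℕ) (k : ℕ) : ℚ :=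
  (Finset.univ.val.map fun i => (a i : ℚ)).esymm k

theorem exists_perm_of_multiset_map_eq {c : ℕ} {a b : Fin c → ℕ}
    (h : Finset.univ.val.map a = Finset.univ.val.map b) : ∃ σ : Equiv.Perm (Fin c), b = a ∘ σ := by
  rw [Fin.univ_val_map, Fin.univ_val_map, Multiset.coe_eq_coe] at h
  have h1 : List.ofFn (a ∘ Tuple.sort a) = List.ofFn (b ∘ Tuple.sort b) :=
    List.Perm.eq_of_sortedLE (Tuple.monotone_sort a).sortedLE_ofFn
      (Tuple.monotone_sort b).sortedLE_ofFn
      (((Tuple.sort a).ofFn_comp_perm a).trans (h.trans ((Tuple.sort b).ofFn_comp_perm b).symm))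
  have h2 := List.ofFn_injective h1
  refine ⟨(Tuple.sort b)⁻¹.trans (Tuple.sort a), ?_⟩
  funext i
  have := congrFun h2 ((Tuple.sort b)⁻¹ i)
  simpa using this.symm

theorem exists_perm_of_degreeEsymm_eq {c : ℕ} {a b : Fin c → ℕ}
    (h : ∀ k, 0 < k → k ≤ c → degreeEsymm a k = degreeEsymm b k) :
    ∃ σ : Equiv.Perm (Fin c), b = a ∘ σ := by
  apply exists_perm_of_multiset_map_eq
  have hprod : ∀ a : Fin c → ℕ, ((Finset.univ.val.map fun i => (a i : ℚ)).map fun t =>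
      Polynomial.X - Polynomial.C t).prod = ∑ j ∈ Finset.range (c + 1), (-1) ^ j *
        (Polynomial.C (degreeEsymm a j) * Polynomial.X ^ (c - j)) := by
    intro a
    rw [Multiset.prod_X_sub_X_eq_sum_esymm]
    simp [degreeEsymm]
  have h1 : Finset.univ.val.map (fun i => (a i : ℚ)) =
      Finset.univ.val.map (fun i => (b i : ℚ)) := by
    rw [← Polynomial.roots_multiset_prod_X_sub_C (Finset.univ.val.map fun i => (a i : ℚ)),
      ← Polynomial.roots_multiset_prod_X_sub_C (Finset.univ.val.map fun i => (b i : ℚ)),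
      hprod, hprod]
    congr 1
    refine Finset.sum_congr rfl fun j hj => ?_
    rcases Nat.eq_zero_or_pos j with rfl | hj0
    · simp [degreeEsymm, Multiset.esymm]
    · rw [h j hj0 (Nat.lt_succ_iff.1 (Finset.mem_range.1 hj))]
  refine Multiset.map_injective (Nat.cast_injective (R := ℚ)) ?_
  simpa [Multiset.map_map, Function.comp_def] using h1

theorem degreeEsymm_self {c : ℕ} (a : Fin c → ℕ) : degreeEsymm a c = ((∏ i, a i : ℕ) : ℚ) := by
  have h : Finset.powersetCard c (Finset.univ : Finset (Fin c)) = {Finset.univ} := by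
    simpa using Finset.powersetCard_self (Finset.univ : Finset (Fin c))
  rw [degreeEsymm, Finset.esymm_map_val, h, Finset.sum_singleton, Nat.cast_prod]

theorem degreeEsymm_eq_zero {c : ℕ} (a : Fin c → ℕ) {k : ℕ} (hk : c < k) : degreeEsymm a k = 0 := by
  rw [degreeEsymm, Multiset.esymm, Multiset.powersetCard_eq_empty _ (by simpa using hk)]
  rfl

theorem degreeEsymm_pos {c : ℕ} {a : Fin c → ℕ} (ha : ∀ i, 0 < a i) {k : ℕ} (hk : k ≤ c) :
    0 < degreeEsymm a k := by
  rw [degreeEsymm, Finset.esymm_map_val]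
  refine Finset.sum_pos (fun t _ => Finset.prod_pos fun i _ => Nat.cast_pos.2 (ha i)) ?_
  rw [Finset.powersetCard_nonempty]
  simpa using hk

/-- Newton's identities, valid beyond `c` as well, where the elementary symmetric functions
vanish. -/
theorem sum_pow_eq_degreeEsymm {c : ℕ} (a : Fin c → ℕ) (m : ℕ) :
    ((∑ i, a i ^ (m + 1) : ℕ) : ℚ) = (-1) ^ m * (m + 1) * degreeEsymm a (m + 1) +
      ∑ j ∈ Finset.range m,
        (-1) ^ j * degreeEsymm a (j + 1) * ((∑ i, a i ^ (m - j) : ℕ) : ℚ) := by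
  have h := congrArg (MvPolynomial.aeval fun i => (a i : ℚ))
    (MvPolynomial.psum_eq_mul_esymm_sub_sum (Fin c) ℚ (m + 1) m.succ_pos)
  have hp : ∀ k, MvPolynomial.aeval (fun i => (a i : ℚ)) (MvPolynomial.psum (Fin c) ℚ k) =
      ((∑ i, a i ^ k : ℕ) : ℚ) := fun k => by simp [MvPolynomial.psum]
  have he : ∀ k, MvPolynomial.aeval (fun i => (a i : ℚ)) (MvPolynomial.esymm (Fin c) ℚ k) =
      degreeEsymm a k := fun k => MvPolynomial.aeval_esymm_eq_multiset_esymm _ _ _ _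
  simp only [map_sub, map_sum, map_mul, map_pow, map_neg, map_one, map_natCast, hp, he,
    Finset.sum_filter, apply_ite (MvPolynomial.aeval fun i => (a i : ℚ)), map_zero] at h
  rw [h, Finset.Nat.sum_antidiagonal_eq_sum_range_succ_mk, Finset.sum_range_succ,
    Finset.sum_range_succ']
  simp only [Set.mem_Ioo, lt_irrefl, false_and, and_false, if_false, add_zero]
  rw [sub_eq_add_neg, ← Finset.sum_neg_distrib]
  congr 1
  · push_cast
    ring
  · refine Finset.sum_congr rfl fun j hj => ?_
    rw [if_pos ⟨j.succ_pos, by simpa using hj⟩, Nat.add_sub_add_right]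
    ring

theorem sum_pow_one {c : ℕ} (a : Fin c → ℕ) :
    ((∑ i, a i ^ 1 : ℕ) : ℚ) =
      degreeEsymm a 1 := by
  have h := sum_pow_eq_degreeEsymm a 0
  simp only [Finset.sum_range_zero] at h
  norm_num only at h
  linear_combination h

theorem sum_pow_two {c : ℕ} (a : Fin c → ℕ) :
    ((∑ i, a i ^ 2 : ℕ) : ℚ) =
      degreeEsymm a 1 ^ 2 - 2 * degreeEsymm a 2 := by
  have h := sum_pow_eq_degreeEsymm a 1
  simp only [Finset.sum_range_succ, Finset.sum_range_zero] at h
  norm_num only at h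
  rw [sum_pow_one] at h
  linear_combination h

theorem sum_pow_three {c : ℕ} (a : Fin c → ℕ) :
    ((∑ i, a i ^ 3 : ℕ) : ℚ) =
      degreeEsymm a 1 ^ 3 - 3 * degreeEsymm a 1 * degreeEsymm a 2 + 3 * degreeEsymm a 3 := by
  have h := sum_pow_eq_degreeEsymm a 2
  simp only [Finset.sum_range_succ, Finset.sum_range_zero] at h
  norm_num only at h
  rw [sum_pow_one, sum_pow_two] at h
  linear_combination h

theorem sum_pow_four {c : ℕ} (a : Fin c → ℕ) :
    ((∑ i, a i ^ 4 : ℕ) : ℚ) =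
      degreeEsymm a 1 ^ 4 - 4 * degreeEsymm a 1 ^ 2 * degreeEsymm a 2 + 2 * degreeEsymm a 2 ^ 2 +
        4 * degreeEsymm a 1 * degreeEsymm a 3 - 4 * degreeEsymm a 4 := by
  have h := sum_pow_eq_degreeEsymm a 3
  simp only [Finset.sum_range_succ, Finset.sum_range_zero] at h
  norm_num only at h
  rw [sum_pow_one, sum_pow_two, sum_pow_three] at h
  linear_combination h

theorem sum_pow_five {c : ℕ} (a : Fin c → ℕ) :
    ((∑ i, a i ^ 5 : ℕ) : ℚ) =
      degreeEsymm a 1 ^ 5 - 5 * degreeEsymm a 1 ^ 3 * degreeEsymm a 2 +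
        5 * degreeEsymm a 1 * degreeEsymm a 2 ^ 2 + 5 * degreeEsymm a 1 ^ 2 * degreeEsymm a 3 -
        5 * degreeEsymm a 2 * degreeEsymm a 3 - 5 * degreeEsymm a 1 * degreeEsymm a 4 +
        5 * degreeEsymm a 5 := by
  have h := sum_pow_eq_degreeEsymm a 4
  simp only [Finset.sum_range_succ, Finset.sum_range_zero] at h
  norm_num only at h
  rw [sum_pow_one, sum_pow_two, sum_pow_three, sum_pow_four] at h
  linear_combination h

theorem sum_pow_six {c : ℕ} (a : Fin c → ℕ) :
    ((∑ i, a i ^ 6 : ℕ) : ℚ) =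
      degreeEsymm a 1 ^ 6 - 6 * degreeEsymm a 1 ^ 4 * degreeEsymm a 2 +
        9 * degreeEsymm a 1 ^ 2 * degreeEsymm a 2 ^ 2 - 2 * degreeEsymm a 2 ^ 3 +
        6 * degreeEsymm a 1 ^ 3 * degreeEsymm a 3 -
        12 * degreeEsymm a 1 * degreeEsymm a 2 * degreeEsymm a 3 + 3 * degreeEsymm a 3 ^ 2 -
        6 * degreeEsymm a 1 ^ 2 * degreeEsymm a 4 + 6 * degreeEsymm a 2 * degreeEsymm a 4 +
        6 * degreeEsymm a 1 * degreeEsymm a 5 - 6 * degreeEsymm a 6 := by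
  have h := sum_pow_eq_degreeEsymm a 5
  simp only [Finset.sum_range_succ, Finset.sum_range_zero] at h
  norm_num only at h
  rw [sum_pow_one, sum_pow_two, sum_pow_three, sum_pow_four, sum_pow_five] at h
  linear_combination h

theorem sum_pow_seven {c : ℕ} (a : Fin c → ℕ) :
    ((∑ i, a i ^ 7 : ℕ) : ℚ) =
      degreeEsymm a 1 ^ 7 - 7 * degreeEsymm a 1 ^ 5 * degreeEsymm a 2 +
        14 * degreeEsymm a 1 ^ 3 * degreeEsymm a 2 ^ 2 -
        7 * degreeEsymm a 1 * degreeEsymm a 2 ^ 3 + 7 * degreeEsymm a 1 ^ 4 * degreeEsymm a 3 -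
        21 * degreeEsymm a 1 ^ 2 * degreeEsymm a 2 * degreeEsymm a 3 +
        7 * degreeEsymm a 2 ^ 2 * degreeEsymm a 3 + 7 * degreeEsymm a 1 * degreeEsymm a 3 ^ 2 -
        7 * degreeEsymm a 1 ^ 3 * degreeEsymm a 4 +
        14 * degreeEsymm a 1 * degreeEsymm a 2 * degreeEsymm a 4 -
        7 * degreeEsymm a 3 * degreeEsymm a 4 + 7 * degreeEsymm a 1 ^ 2 * degreeEsymm a 5 -
        7 * degreeEsymm a 2 * degreeEsymm a 5 - 7 * degreeEsymm a 1 * degreeEsymm a 6 +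
        7 * degreeEsymm a 7 := by
  have h := sum_pow_eq_degreeEsymm a 6
  simp only [Finset.sum_range_succ, Finset.sum_range_zero] at h
  norm_num only at h
  rw [sum_pow_one, sum_pow_two, sum_pow_three, sum_pow_four, sum_pow_five, sum_pow_six] at h
  linear_combination h

theorem sum_pow_eight {c : ℕ} (a : Fin c → ℕ) :
    ((∑ i, a i ^ 8 : ℕ) : ℚ) =
      degreeEsymm a 1 ^ 8 - 8 * degreeEsymm a 1 ^ 6 * degreeEsymm a 2 +
        20 * degreeEsymm a 1 ^ 4 * degreeEsymm a 2 ^ 2 -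
        16 * degreeEsymm a 1 ^ 2 * degreeEsymm a 2 ^ 3 + 2 * degreeEsymm a 2 ^ 4 +
        8 * degreeEsymm a 1 ^ 5 * degreeEsymm a 3 -
        32 * degreeEsymm a 1 ^ 3 * degreeEsymm a 2 * degreeEsymm a 3 +
        24 * degreeEsymm a 1 * degreeEsymm a 2 ^ 2 * degreeEsymm a 3 +
        12 * degreeEsymm a 1 ^ 2 * degreeEsymm a 3 ^ 2 -
        8 * degreeEsymm a 2 * degreeEsymm a 3 ^ 2 - 8 * degreeEsymm a 1 ^ 4 * degreeEsymm a 4 +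
        24 * degreeEsymm a 1 ^ 2 * degreeEsymm a 2 * degreeEsymm a 4 -
        8 * degreeEsymm a 2 ^ 2 * degreeEsymm a 4 -
        16 * degreeEsymm a 1 * degreeEsymm a 3 * degreeEsymm a 4 + 4 * degreeEsymm a 4 ^ 2 +
        8 * degreeEsymm a 1 ^ 3 * degreeEsymm a 5 -
        16 * degreeEsymm a 1 * degreeEsymm a 2 * degreeEsymm a 5 +
        8 * degreeEsymm a 3 * degreeEsymm a 5 - 8 * degreeEsymm a 1 ^ 2 * degreeEsymm a 6 +
        8 * degreeEsymm a 2 * degreeEsymm a 6 + 8 * degreeEsymm a 1 * degreeEsymm a 7 -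
        8 * degreeEsymm a 8 := by
  have h := sum_pow_eq_degreeEsymm a 7
  simp only [Finset.sum_range_succ, Finset.sum_range_zero] at h
  norm_num only at h
  rw [sum_pow_one, sum_pow_two, sum_pow_three, sum_pow_four, sum_pow_five, sum_pow_six,
    sum_pow_seven] at h
  linear_combination h

/-! ### Positivity of polynomials in elementary symmetric functions -/

theorem esymm_cons {R : Type*} [CommSemiring R] (x : R) (s : Multiset R) (k : ℕ) :
    (x ::ₘ s).esymm (k + 1) = s.esymm (k + 1) + x * s.esymm k := by
  simp [Multiset.esymm, Multiset.powersetCard_cons, Multiset.sum_map_mul_left]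

theorem esymm_zero_right {R : Type*} [CommSemiring R] (s : Multiset R) : s.esymm 0 = 1 := by
  simp [Multiset.esymm]

theorem esymm_zero_left {R : Type*} [CommSemiring R] (k : ℕ) :
    (0 : Multiset R).esymm (k + 1) = 0 := by
  simp [Multiset.esymm, Multiset.powersetCard_zero_right]

theorem esymm_nonneg {s : Multiset ℚ} (hs : ∀ x ∈ s, 0 < x) (k : ℕ) : 0 ≤ s.esymm k := by
  induction s using Multiset.induction_on generalizing k with
  | empty =>
    cases k with
    | zero => simp [esymm_zero_right]
    | succ k => rw [esymm_zero_left]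
  | cons x s ih =>
    cases k with
    | zero => simp [esymm_zero_right]
    | succ k =>
      have hs' : ∀ y ∈ s, 0 < y := fun y hy => hs y (Multiset.mem_cons_of_mem hy)
      have hx := hs x (Multiset.mem_cons_self x s)
      rw [esymm_cons]
      exact add_nonneg (ih hs' _) (mul_nonneg hx.le (ih hs' _))

theorem esymm_one_pos {s : Multiset ℚ} (hs : ∀ x ∈ s, 0 < x) (h : 0 < s.card) :
    0 < s.esymm 1 := by
  obtain ⟨x, hx⟩ := Multiset.card_pos_iff_exists_mem.1 h
  obtain ⟨t, rfl⟩ := Multiset.exists_cons_of_mem hx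
  rw [esymm_cons x t 0, esymm_zero_right, mul_one]
  exact add_pos_of_nonneg_of_pos
    (esymm_nonneg (fun y hy => hs y (Multiset.mem_cons_of_mem hy)) 1) (hs x hx)

theorem esymm_one_mul_two_sub_three_nonneg {s : Multiset ℚ} (hs : ∀ x ∈ s, 0 < x) :
    0 ≤ s.esymm 1 * s.esymm 2 - s.esymm 3 := by
  induction s using Multiset.induction_on with
  | empty => simp [esymm_zero_left]
  | cons x s ih =>
    have hs' : ∀ y ∈ s, 0 < y := fun y hy => hs y (Multiset.mem_cons_of_mem hy)
    have hx := hs x (Multiset.mem_cons_self x s)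
    have h1 := esymm_nonneg hs' 1
    have h2 := ih hs'
    rw [esymm_cons x s 0, esymm_cons x s 1, esymm_cons x s 2, esymm_zero_right]
    have : 0 ≤ x * s.esymm 1 ^ 2 + x ^ 2 * s.esymm 1 := by positivity
    linear_combination h2 + this

theorem esymm_one_mul_two_sub_three_pos {s : Multiset ℚ} (hs : ∀ x ∈ s, 0 < x) (h : 1 < s.card) :
    0 < s.esymm 1 * s.esymm 2 - s.esymm 3 := by
  obtain ⟨x, hx⟩ := Multiset.card_pos_iff_exists_mem.1 (zero_lt_one.trans h)
  obtain ⟨t, rfl⟩ := Multiset.exists_cons_of_mem hx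
  have hs' : ∀ y ∈ t, 0 < y := fun y hy => hs y (Multiset.mem_cons_of_mem hy)
  have hx := hs x hx
  have h1 : 0 < t.esymm 1 := esymm_one_pos hs' (by simpa using h)
  have h2 := esymm_one_mul_two_sub_three_nonneg hs'
  rw [esymm_cons x t 0, esymm_cons x t 1, esymm_cons x t 2, esymm_zero_right]
  have : 0 < x * t.esymm 1 ^ 2 + x ^ 2 * t.esymm 1 := by positivity
  linear_combination h2 + this

/-- The coefficient of `x` in the change of `e₁e₂e₃ - e₁²e₄ + e₁e₅ - e₃²` under adjoining an
element `x` is `e₂(e₁e₂ - e₃) - (e₁e₄ - e₅)`, which is nonnegative for the same reason. -/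
theorem esymm_hurwitz_increment_nonneg {s : Multiset ℚ} (hs : ∀ x ∈ s, 0 < x) :
    0 ≤ s.esymm 2 * (s.esymm 1 * s.esymm 2 - s.esymm 3) -
      (s.esymm 1 * s.esymm 4 - s.esymm 5) := by
  induction s using Multiset.induction_on with
  | empty => simp [esymm_zero_left]
  | cons x s ih =>
    have hs' : ∀ y ∈ s, 0 < y := fun y hy => hs y (Multiset.mem_cons_of_mem hy)
    have hx := hs x (Multiset.mem_cons_self x s)
    have h1 := esymm_nonneg hs' 1
    have h2 := ih hs'
    have h3 := esymm_one_mul_two_sub_three_nonneg hs'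
    rw [esymm_cons x s 0, esymm_cons x s 1, esymm_cons x s 2, esymm_cons x s 3,
      esymm_cons x s 4, esymm_zero_right]
    have : 0 ≤ x * (2 * s.esymm 1 * (s.esymm 1 * s.esymm 2 - s.esymm 3)) +
      x ^ 2 * ((s.esymm 1 * s.esymm 2 - s.esymm 3) + s.esymm 1 ^ 3) + x ^ 3 * s.esymm 1 ^ 2 := by
      positivity
    linear_combination h2 + this

/-- Nonnegativity of the third Hurwitz determinant of the stable polynomial `∏ (T + x)`. Adjoining
an element `x` changes it by a polynomial in `x` whose coefficients are again nonnegative. -/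
theorem esymm_hurwitz_nonneg {s : Multiset ℚ} (hs : ∀ x ∈ s, 0 < x) :
    0 ≤ s.esymm 1 * s.esymm 2 * s.esymm 3 - s.esymm 1 ^ 2 * s.esymm 4 +
      s.esymm 1 * s.esymm 5 - s.esymm 3 ^ 2 := by
  induction s using Multiset.induction_on with
  | empty => simp [esymm_zero_left]
  | cons x s ih =>
    have hs' : ∀ y ∈ s, 0 < y := fun y hy => hs y (Multiset.mem_cons_of_mem hy)
    have hx := hs x (Multiset.mem_cons_self x s)
    have h1 := esymm_nonneg hs' 1
    have h2 := ih hs'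
    have h3 := esymm_one_mul_two_sub_three_nonneg hs'
    have h4 := esymm_hurwitz_increment_nonneg hs'
    rw [esymm_cons x s 0, esymm_cons x s 1, esymm_cons x s 2, esymm_cons x s 3,
      esymm_cons x s 4, esymm_zero_right]
    have h5 := mul_nonneg hx.le h4
    have h6 : 0 ≤ x ^ 2 * (s.esymm 1 * (s.esymm 1 * s.esymm 2 - s.esymm 3)) +
      x ^ 3 * (s.esymm 1 * s.esymm 2 - s.esymm 3) := by positivity
    linear_combination h2 + h5 + h6

/-! ### Bernoulli numbers -/

theorem bernoulli_four_ne_zero : bernoulli 4 ≠ 0 := by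
  rw [bernoulli_eq_bernoulli'_of_ne_one (by norm_num), bernoulli'_four]
  norm_num

theorem bernoulli_six : bernoulli 6 = 1 / 42 := by
  rw [bernoulli_eq_bernoulli'_of_ne_one (by norm_num), bernoulli'_def]
  norm_num [Finset.sum_range_succ, Nat.choose, bernoulli'_eq_zero_of_odd (show Odd 5 by decide)]

theorem bernoulli_eight : bernoulli 8 = -1 / 30 := by
  have h6 : bernoulli' 6 = 1 / 42 := by
    rw [← bernoulli_eq_bernoulli'_of_ne_one (by norm_num), bernoulli_six]
  rw [bernoulli_eq_bernoulli'_of_ne_one (by norm_num), bernoulli'_def]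
  norm_num [Finset.sum_range_succ, Nat.choose, bernoulli'_eq_zero_of_odd (show Odd 5 by decide),
    bernoulli'_eq_zero_of_odd (show Odd 7 by decide), h6]

/-! ### Criteria for firmness -/

theorem firmnessIndex_eq (K : Type*) [Field K] {c N : ℕ} (hN : Firm K c N)
    (h : ∀ n, c ≤ n → n < N → ¬ Firm K c n) : firmnessIndex K c = N := by
  refine IsLeast.csInf_eq ⟨⟨N, hN, rfl⟩, ?_⟩
  rintro _ ⟨n, hn, rfl⟩
  exact Nat.cast_le.2 (not_lt.1 fun hlt => h n hn.1 hlt hn)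

/-- Two degree sequences of which one has an entry missing in the other disprove firmness. -/
theorem not_firm (K : Type*) [Field K] {c n : ℕ} (hcn : c ≤ n) (a b : Fin c → ℕ)
    (ha : ∀ i, 0 < a i) (hb : ∀ i, 0 < b i) (hprod : ∏ i, a i = ∏ i, b i)
    (hsum : ∀ k < n - c, bernoulli (k + 1) ≠ 0 → ∑ i, a i ^ (k + 1) = ∑ i, b i ^ (k + 1))
    (i : Fin c) (hi : ∀ j, b j ≠ a i) : ¬ Firm K c n := by
  rw [firm_iff K hcn]
  intro h
  obtain ⟨σ, rfl⟩ := h a b ha hb hprod hsum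
  exact hi (σ⁻¹ i) (by simp)

theorem firm_of_degreeEsymm_eq (K : Type*) [Field K] {c n : ℕ} (hcn : c ≤ n)
    (h : ∀ a b : Fin c → ℕ, (∀ i, 0 < a i) → (∀ i, 0 < b i) →
      degreeEsymm a c = degreeEsymm b c →
      (∀ k < n - c, bernoulli (k + 1) ≠ 0 →
        ((∑ i, a i ^ (k + 1) : ℕ) : ℚ) = ((∑ i, b i ^ (k + 1) : ℕ) : ℚ)) →
      ∀ k, 0 < k → k ≤ c → degreeEsymm a k = degreeEsymm b k) : Firm K c n := by
  rw [firm_iff K hcn]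
  intro a b ha hb hprod hsum
  refine exists_perm_of_degreeEsymm_eq (h a b ha hb ?_ ?_)
  · rw [degreeEsymm_self, degreeEsymm_self, hprod]
  · intro k hk hB
    rw [hsum k hk hB]

/-! ### Consequences of equal power sums -/

theorem degreeEsymm_one_eq {c : ℕ} {a b : Fin c → ℕ}
    (h : ((∑ i, a i ^ 1 : ℕ) : ℚ) = ((∑ i, b i ^ 1 : ℕ) : ℚ)) :
    degreeEsymm a 1 = degreeEsymm b 1 := by
  rwa [sum_pow_one, sum_pow_one] at h

theorem degreeEsymm_two_eq {c : ℕ} {a b : Fin c → ℕ} (h1 : degreeEsymm a 1 = degreeEsymm b 1)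
    (h : ((∑ i, a i ^ 2 : ℕ) : ℚ) = ((∑ i, b i ^ 2 : ℕ) : ℚ)) :
    degreeEsymm a 2 = degreeEsymm b 2 := by
  rw [sum_pow_two, sum_pow_two, h1] at h
  linear_combination (-1 / 2) * h

theorem degreeEsymm_four_eq {c : ℕ} {a b : Fin c → ℕ} (h1 : degreeEsymm a 1 = degreeEsymm b 1)
    (h2 : degreeEsymm a 2 = degreeEsymm b 2)
    (h : ((∑ i, a i ^ 4 : ℕ) : ℚ) = ((∑ i, b i ^ 4 : ℕ) : ℚ)) :
    degreeEsymm b 4 = degreeEsymm a 4 + degreeEsymm a 1 * (degreeEsymm b 3 - degreeEsymm a 3) := by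
  rw [sum_pow_four, sum_pow_four, ← h1, ← h2] at h
  linear_combination (1 / 4) * h

/-- The relation that the sixth power sum adds; the left side vanishes for `c = 5`, where `e₅` is
the product of the degrees. -/
theorem degreeEsymm_one_mul_five_sub_eq {c : ℕ} {a b : Fin c → ℕ}
    (h1 : degreeEsymm a 1 = degreeEsymm b 1) (h2 : degreeEsymm a 2 = degreeEsymm b 2)
    (h4 : ((∑ i, a i ^ 4 : ℕ) : ℚ) = ((∑ i, b i ^ 4 : ℕ) : ℚ))
    (h : ((∑ i, a i ^ 6 : ℕ) : ℚ) = ((∑ i, b i ^ 6 : ℕ) : ℚ))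
    (h6 : degreeEsymm a 6 = degreeEsymm b 6) :
    2 * degreeEsymm a 1 * (degreeEsymm b 5 - degreeEsymm a 5) =
      (degreeEsymm b 3 - degreeEsymm a 3) *
        ((degreeEsymm a 1 * degreeEsymm a 2 - degreeEsymm a 3) +
          (degreeEsymm b 1 * degreeEsymm b 2 - degreeEsymm b 3)) := by
  rw [sum_pow_six, sum_pow_six, ← h1, ← h2, ← h6, degreeEsymm_four_eq h1 h2 h4] at h
  rw [← h1, ← h2]
  linear_combination (-1 / 3) * h

theorem degreeEsymm_one_mul_two_sub_three_pos {c : ℕ} {a : Fin c → ℕ} (ha : ∀ i, 0 < a i)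
    (hc : 1 < c) :
    0 < degreeEsymm a 1 * degreeEsymm a 2 - degreeEsymm a 3 :=
  esymm_one_mul_two_sub_three_pos (by simpa using ha) (by simpa using hc)

theorem degreeEsymm_hurwitz_nonneg {c : ℕ} {a : Fin c → ℕ} (ha : ∀ i, 0 < a i) :
    0 ≤ degreeEsymm a 1 * degreeEsymm a 2 * degreeEsymm a 3 -
      degreeEsymm a 1 ^ 2 * degreeEsymm a 4 + degreeEsymm a 1 * degreeEsymm a 5 -
      degreeEsymm a 3 ^ 2 :=
  esymm_hurwitz_nonneg (by simpa using ha)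

/-! ### The firmness indices -/

theorem firm_one (K : Type*) [Field K] : Firm K 1 1 := by
  refine firm_of_degreeEsymm_eq K le_rfl fun a b _ _ h1 _ k hk hk1 => ?_
  interval_cases k
  exact h1

theorem firm_two (K : Type*) [Field K] : Firm K 2 3 := by
  refine firm_of_degreeEsymm_eq K (by norm_num) fun a b _ _ h2 hs k hk hk2 => ?_
  have h1 := degreeEsymm_one_eq (hs 0 (by norm_num) (by norm_num))
  interval_cases k
  exacts [h1, h2]

theorem firm_three (K : Type*) [Field K] : Firm K 3 5 := by
  refine firm_of_degreeEsymm_eq K (by norm_num) fun a b _ _ h3 hs k hk hk3 => ?_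
  have h1 := degreeEsymm_one_eq (hs 0 (by norm_num) (by norm_num))
  have h2 := degreeEsymm_two_eq h1 (hs 1 (by norm_num) (by norm_num [bernoulli_two]))
  interval_cases k
  exacts [h1, h2, h3]

theorem firm_four (K : Type*) [Field K] : Firm K 4 8 := by
  refine firm_of_degreeEsymm_eq K (by norm_num) fun a b ha _ h4 hs k hk hk4 => ?_
  have h1 := degreeEsymm_one_eq (hs 0 (by norm_num) (by norm_num))
  have h2 := degreeEsymm_two_eq h1 (hs 1 (by norm_num) (by norm_num [bernoulli_two]))
  have hpos : 0 < degreeEsymm a 1 := degreeEsymm_pos ha (by norm_num)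
  have h3 := degreeEsymm_four_eq h1 h2 (hs 3 (by norm_num) bernoulli_four_ne_zero)
  rw [h4, eq_comm, add_eq_left, mul_eq_zero, or_iff_right hpos.ne', sub_eq_zero] at h3
  interval_cases k
  exacts [h1, h2, h3.symm, h4]

theorem firm_five (K : Type*) [Field K] : Firm K 5 11 := by
  refine firm_of_degreeEsymm_eq K (by norm_num) fun a b ha hb h5 hs => ?_
  have h1 := degreeEsymm_one_eq (hs 0 (by norm_num) (by norm_num))
  have h2 := degreeEsymm_two_eq h1 (hs 1 (by norm_num) (by norm_num [bernoulli_two]))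
  have hp4 := hs 3 (by norm_num) bernoulli_four_ne_zero
  have h6 : degreeEsymm a 6 = degreeEsymm b 6 := by
    rw [degreeEsymm_eq_zero a (by norm_num), degreeEsymm_eq_zero b (by norm_num)]
  have h := degreeEsymm_one_mul_five_sub_eq h1 h2 hp4
    (hs 5 (by norm_num) (by norm_num [bernoulli_six])) h6
  have h3 : degreeEsymm a 3 = degreeEsymm b 3 := by
    rw [h5, sub_self, mul_zero, eq_comm, mul_eq_zero] at h
    have hpos := add_pos (degreeEsymm_one_mul_two_sub_three_pos ha (by norm_num))
      (degreeEsymm_one_mul_two_sub_three_pos hb (by norm_num))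
    linear_combination -(h.resolve_right hpos.ne')
  have h4 := degreeEsymm_four_eq h1 h2 hp4
  rw [h3, sub_self, mul_zero, add_zero] at h4
  intro k hk hk5
  interval_cases k
  exacts [h1, h2, h3, h4.symm, h5]

/-- With `u` the difference of the values of `e₃`, the power sums of exponents 4 and 6 express the
differences of `e₄` and `e₅` through `u`. The one of exponent 8 then says that `u` times the sum of
the two Hurwitz determinants and of `u² / 2` is zero, and these determinants are nonnegative. -/
theorem firm_six (K : Type*) [Field K] : Firm K 6 14 := by
  refine firm_of_degreeEsymm_eq K (by norm_num) fun a b ha hb h6 hs => ?_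
  have h1 := degreeEsymm_one_eq (hs 0 (by norm_num) (by norm_num))
  have h2 := degreeEsymm_two_eq h1 (hs 1 (by norm_num) (by norm_num [bernoulli_two]))
  have hp4 := hs 3 (by norm_num) bernoulli_four_ne_zero
  have h4 := degreeEsymm_four_eq h1 h2 hp4
  have h5 := degreeEsymm_one_mul_five_sub_eq h1 h2 hp4
    (hs 5 (by norm_num) (by norm_num [bernoulli_six])) h6
  have h8 := hs 7 (by norm_num) (by norm_num [bernoulli_eight])
  have hpos : 0 < degreeEsymm a 1 := degreeEsymm_pos ha (by norm_num)
  have hGa := degreeEsymm_hurwitz_nonneg ha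
  have hGb := degreeEsymm_hurwitz_nonneg hb
  rw [sum_pow_eight, sum_pow_eight, degreeEsymm_eq_zero a (show 6 < 7 by norm_num),
    degreeEsymm_eq_zero b (show 6 < 7 by norm_num), degreeEsymm_eq_zero a (show 6 < 8 by norm_num),
    degreeEsymm_eq_zero b (show 6 < 8 by norm_num), ← h1, ← h2, ← h6, h4] at h8
  rw [← h1, ← h2, h4] at hGb
  rw [← h1, ← h2] at h5
  have h3 : degreeEsymm b 3 - degreeEsymm a 3 = 0 := by
    by_contra hu
    have key : (degreeEsymm b 3 - degreeEsymm a 3) * (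
      (degreeEsymm a 1 * degreeEsymm a 2 * degreeEsymm a 3 -
        degreeEsymm a 1 ^ 2 * degreeEsymm a 4 + degreeEsymm a 1 * degreeEsymm a 5 -
        degreeEsymm a 3 ^ 2) + (degreeEsymm a 1 * degreeEsymm a 2 * degreeEsymm b 3 -
        degreeEsymm a 1 ^ 2 * (degreeEsymm a 4 +
          degreeEsymm a 1 * (degreeEsymm b 3 - degreeEsymm a 3)) +
        degreeEsymm a 1 * degreeEsymm b 5 - degreeEsymm b 3 ^ 2) +
        (degreeEsymm b 3 - degreeEsymm a 3) ^ 2 / 2) = 0 := by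
      -- `h5` eliminates the product `e₁ Δe₅`; the cubic in its multiplier is the complete
      -- homogeneous function `e₁³ - 2e₁e₂ + e₃`, by which `8e₅` is multiplied in the eighth power sum
      linear_combination (-1 / 4 * degreeEsymm a 1) * h8 -
        (degreeEsymm a 1 ^ 3 - 2 * degreeEsymm a 1 * degreeEsymm a 2 + degreeEsymm a 3 +
          (degreeEsymm b 3 - degreeEsymm a 3) / 2) * h5
    have hsq : 0 < (degreeEsymm b 3 - degreeEsymm a 3) ^ 2 := by positivity
    have := (mul_eq_zero.1 key).resolve_left hu
    linarith
  rw [h3, mul_zero, add_zero] at h4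
  rw [h3, zero_mul, mul_eq_zero] at h5
  have h5 := h5.resolve_left (by positivity)
  intro k hk hk6
  interval_cases k
  exacts [h1, h2, (sub_eq_zero.1 h3).symm, h4.symm, (sub_eq_zero.1 h5).symm, h6]

theorem theorem4p1 (K : Type*) [Field K] :
    firmnessIndex K 1 = 1 ∧ firmnessIndex K 2 = 3 ∧ firmnessIndex K 3 = 5 ∧
      firmnessIndex K 4 = 8 ∧ firmnessIndex K 5 = 11 ∧ firmnessIndex K 6 = 14 := by
  -- the odd power sums of exponent at least 3 do not matter, so each pair need only agree in the
  -- product and in the power sums of exponents 1, 2, 4 and 6 that are at most `n - c`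
  have hB3 : bernoulli 3 = 0 := bernoulli_eq_zero_of_odd (by decide) (by norm_num)
  have hB5 : bernoulli 5 = 0 := bernoulli_eq_zero_of_odd (by decide) (by norm_num)
  have hB7 : bernoulli 7 = 0 := bernoulli_eq_zero_of_odd (by decide) (by norm_num)
  refine ⟨firmnessIndex_eq (N := 1) K (firm_one K) fun n hn hlt => absurd hn hlt.not_ge,
    firmnessIndex_eq (N := 3) K (firm_two K) fun n hn hlt => ?_,
    firmnessIndex_eq (N := 5) K (firm_three K) fun n hn hlt => ?_,
    firmnessIndex_eq (N := 8) K (firm_four K) fun n hn hlt => ?_,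
    firmnessIndex_eq (N := 11) K (firm_five K) fun n hn hlt => ?_,
    firmnessIndex_eq (N := 14) K (firm_six K) fun n hn hlt => ?_⟩
  · refine not_firm K hn ![1, 4] ![2, 2] (by decide) (by decide) (by decide) ?_ 0 (by decide)
    intro k hk
    omega
  · refine not_firm K hn ![1, 6, 6] ![2, 2, 9] (by decide) (by decide) (by decide) ?_ 0 (by decide)
    intro k hk _
    obtain rfl : k = 0 := by omega
    decide
  · refine not_firm K hn ![2, 6, 7, 15] ![3, 3, 10, 14] (by decide) (by decide) (by decide) ?_ 0
      (by decide)
    intro k hk hB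
    have hk3 : k < 3 := by omega
    interval_cases k
    exacts [by decide, by decide, absurd hB3 hB]
  · refine not_firm K hn ![3, 6, 11, 20, 20] ![4, 4, 15, 15, 22] (by decide) (by decide)
      (by decide) ?_ 0 (by decide)
    intro k hk hB
    have hk5 : k < 5 := by omega
    interval_cases k
    exacts [by decide, by decide, absurd hB3 hB, by decide, absurd hB5 hB]
  · refine not_firm K hn ![5, 12, 15, 32, 36, 46] ![6, 8, 23, 24, 40, 45] (by decide) (by decide)
      (by decide) ?_ 0 (by decide)
    intro k hk hB
    have hk7 : k < 7 := by omega
    interval_cases k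
    exacts [by decide, by decide, absurd hB3 hB, by decide, absurd hB5 hB, by decide,
      absurd hB7 hB]
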